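/- Let $-D<0$ be a fundamental discriminant (i.e. $-D\equiv 1 \pmod 4$ is squarefree, or $-D=4m$ with $m$ squarefree and $m\equiv 2,3\pmod 4$). Let $\mathcal C(-D)$ be the ideal class group of the ring of integers of $\mathbb Q(\sqrt{-D})$, let $h(-D)=|\mathcal C(-D)|$ be the class number, and let $p(-D)=|\mathcal C(-D)^2|$ be the order of the principal genus $\mathcal P(-D)=\mathcal C(-D)^2$, the subgroup of squares. Let $W$ denote the Lambert $W$-function, i.e. the (principal branch of the) inverse function of $w\mapsto we^w$. If $$\frac{D^{1/2}}{(\log D)^{74}}\le h(-D),$$ then $$2\cdot\frac{D^{1/2-\log 2/W(\log D)}}{(\log D)^{74}}\le p(-D).$$ -/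

import Mathlib

open scoped NumberField

namespace GenusBound

/-- `d` is a fundamental discriminant: `d ≠ 1` and either `d` is squarefree with `d ≡ 1 (mod 4)`,
or `d = 4 m` with `m` squarefree and `m ≡ 2, 3 (mod 4)`. -/
def IsFundamentalDiscriminant (d : ℤ) : Prop :=
  d ≠ 1 ∧ ((d % 4 = 1 ∧ Squarefree d) ∨
    ∃ m : ℤ, d = 4 * m ∧ (m % 4 = 2 ∨ m % 4 = 3) ∧ Squarefree m)

/-- The field `ℚ(√d)`, as a subfield of `ℂ`. -/
noncomputable abbrev QuadraticField (d : ℤ) : IntermediateField ℚ ℂ :=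
  IntermediateField.adjoin ℚ {z : ℂ | z ^ 2 = (d : ℂ)}

/-- The class group `𝒞(d)`: the ideal class group of the ring of integers of `ℚ(√d)`. -/
abbrev QuadraticClassGroup (d : ℤ) : Type := ClassGroup (𝓞 (QuadraticField d))

/-- The class number `h(d)`, the order of the class group. -/
noncomputable def h (d : ℤ) : ℕ := Nat.card (QuadraticClassGroup d)

/-- The principal genus `𝒫(d) = 𝒞(d)²`: the subgroup of squares in the class group. -/
noncomputable def principalGenus (d : ℤ) : Subgroup (QuadraticClassGroup d) :=
  (powMonoidHom 2 : QuadraticClassGroup d →* QuadraticClassGroup d).range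

/-- The order `p(d)` of the principal genus. -/
noncomputable def p (d : ℤ) : ℕ := Nat.card (principalGenus d)

/-- The (principal branch of the real) Lambert `W`-function: the inverse of `w ↦ w * exp w`
restricted to `w ≥ -1`, where this map is injective with image `[-1/e, ∞)`. -/
noncomputable def lambertW (x : ℝ) : ℝ :=
  Function.invFunOn (fun w : ℝ => w * Real.exp w) (Set.Ici (-1)) x

/-- For `x ≥ 0`, `lambertW x` is nonnegative and solves `w * exp w = x`. -/
theorem lambertW_spec {x : ℝ} (hx : 0 ≤ x) :
    0 ≤ lambertW x ∧ lambertW x * Real.exp (lambertW x) = x := by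
  have hc : ContinuousOn (fun w : ℝ => w * Real.exp w) (Set.Icc 0 x) := by fun_prop
  have hmem : x ∈ Set.Icc ((fun w : ℝ => w * Real.exp w) 0)
      ((fun w : ℝ => w * Real.exp w) x) := by
    refine ⟨by simpa using hx, ?_⟩
    have := Real.one_le_exp hx
    show x ≤ x * Real.exp x
    nlinarith
  obtain ⟨w, hw, hwx⟩ := intermediate_value_Icc hx hc hmem
  have hex : ∃ a ∈ Set.Ici (-1 : ℝ), (fun w : ℝ => w * Real.exp w) a = x :=
    ⟨w, by have := hw.1; simp only [Set.mem_Ici]; linarith, hwx⟩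
  have heq : lambertW x * Real.exp (lambertW x) = x := Function.invFunOn_eq hex
  refine ⟨?_, heq⟩
  by_contra hneg
  have h1 := mul_neg_of_neg_of_pos (not_le.mp hneg) (Real.exp_pos (lambertW x))
  linarith

end GenusBound

namespace GenusBound

/-! Write `k` for the number of primes dividing `D`. Squaring on the class group has kernel the
2-torsion and image the principal genus, so `h / p` is the order of the 2-torsion. Genus theory
bounds that order by `2 ^ (k - 1)`, giving `2 * h ≤ 2 ^ k * p` (`two_mul_h_le`): the ramified prime
ideals generate the 2-torsion, each has order at most two, and the principal ideal of `√m` (of `1 +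
i` when `m = -1`) gives a relation that makes one of them redundant.

It remains to see that `2 ^ k ≤ D ^ (log 2 / W(log D))`. A discriminant with `k` prime factors
satisfies `k ^ k ≤ D` (`card_primeFactors_pow_self_le`), by comparison with the product of the first
`k` primes. Hence `log k * exp (log k) ≤ log D`, so `k ≤ exp (W(log D)) = log D / W(log D)`
(`two_pow_le_rpow_lambertW`). -/

/-! ### Prime factors of a discriminant: `k ^ k ≤ D`. -/

lemma prod_nth_prime_le_prod (S : Finset ℕ) (hS : ∀ p ∈ S, p.Prime) :
    ∏ i ∈ Finset.range S.card, Nat.nth Nat.Prime i ≤ ∏ p ∈ S, p := by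
  induction S using Finset.induction_on_max with
  | empty => simp
  | insert a s has ih =>
    have ha : a ∉ s := fun h => lt_irrefl _ (has a h)
    rw [Finset.card_insert_of_notMem ha, Finset.prod_range_succ, Finset.prod_insert ha, mul_comm]
    refine Nat.mul_le_mul ?_ (ih fun p hp => hS p (Finset.mem_insert_of_mem hp))
    refine Nat.lt_succ_iff.mp (Nat.nth_lt_of_lt_count ?_)
    rw [Nat.count_eq_card_filter_range, ← Nat.succ_le_iff, Nat.succ_eq_add_one,
      ← Finset.card_insert_of_notMem ha]
    refine Finset.card_le_card fun p hp => ?_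
    simp only [Finset.mem_filter, Finset.mem_range]
    refine ⟨?_, hS p hp⟩
    rcases Finset.mem_insert.mp hp with rfl | h
    · exact Nat.lt_succ_self _
    · exact (has p h).trans (Nat.lt_succ_self _)

lemma le_nth_prime_of_count_le {n k : ℕ} (h : Nat.count Nat.Prime n ≤ k) :
    n ≤ Nat.nth Nat.Prime k :=
  (Nat.count_le_iff_le_nth Nat.infinite_setOfPred_prime).mp h

/-- Primes from 47 on lie in two residue classes mod 6, so `n` consecutive integers starting at 47
contain at most `2 * (n / 6 + 1)` of them, and there are 14 primes below 47. -/
lemma three_mul_sub_one_le_nth_prime {k : ℕ} (hk : 14 ≤ k) :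
    3 * k - 1 ≤ Nat.nth Nat.Prime k := by
  have h47 : Nat.count Nat.Prime 47 = 14 := by norm_num [Nat.count_succ]
  obtain ⟨n, hn⟩ := Nat.exists_eq_add_of_le (le_nth_prime_of_count_le (h47.trans_le hk))
  have h := Nat.primeCounting'_add_le (a := 6) (k := 47) (by norm_num) (by norm_num) n
  rw [← hn, Nat.primeCounting'_nth_eq, Nat.primeCounting', h47,
    show Nat.totient 6 = 2 by decide] at h
  omega

/-- `(1 + 1/k) ^ k ≤ e`, and `e * (k + 1) ≤ 3 * k - 1` holds from `k = 14` on (it fails at 13). -/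
lemma succ_pow_succ_le {k : ℕ} (hk : 14 ≤ k) :
    (k + 1) ^ (k + 1) ≤ k ^ k * (3 * k - 1) := by
  have hk' : (14 : ℝ) ≤ k := by exact_mod_cast hk
  have hk0 : (0 : ℝ) < k := by linarith
  have h1 : ((k : ℝ) + 1) ^ k ≤ (k : ℝ) ^ k * Real.exp 1 := by
    have h2 : (k : ℝ) + 1 ≤ k * Real.exp (1 / k) := by
      have := Real.add_one_le_exp (1 / (k : ℝ))
      calc (k : ℝ) + 1 = k * (1 / k + 1) := by field_simp; ring
        _ ≤ _ := by gcongr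
    calc ((k : ℝ) + 1) ^ k ≤ (k * Real.exp (1 / k)) ^ k := by gcongr
      _ = _ := by rw [mul_pow, ← Real.exp_nat_mul]; congr 2; field_simp
  have h3 := Real.exp_one_lt_d9
  have h4 : Real.exp 1 * (k + 1) ≤ 3 * k - 1 := by nlinarith
  have h5 : ((k : ℝ) + 1) ^ (k + 1) ≤ (k : ℝ) ^ k * (3 * k - 1) := by
    calc ((k : ℝ) + 1) ^ (k + 1) = ((k : ℝ) + 1) ^ k * (k + 1) := pow_succ _ _
      _ ≤ ((k : ℝ) ^ k * Real.exp 1) * (k + 1) := by gcongr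
      _ = (k : ℝ) ^ k * (Real.exp 1 * (k + 1)) := by ring
      _ ≤ _ := by gcongr
  have h6 : ((3 * k - 1 : ℕ) : ℝ) = 3 * k - 1 := by
    rw [Nat.cast_sub (by omega)]; push_cast; ring
  rw [← Nat.cast_le (α := ℝ)]
  push_cast
  rw [h6]
  exact h5

/-- Induction from 14, with the smaller cases by computation. The factor 2 is needed: `4 ^ 4 = 256`
exceeds `2 * 3 * 5 * 7 = 210`. -/
lemma pow_self_le_two_mul_prod_nth_prime (k : ℕ) :
    k ^ k ≤ 2 * ∏ i ∈ Finset.range k, Nat.nth Nat.Prime i := by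
  have base : ∀ k ≤ 14, k ^ k ≤ 2 * ∏ i ∈ Finset.range k, Nat.nth Nat.Prime i := by
    have hl : ∀ n k : ℕ, Nat.count Nat.Prime n ≤ k → n ≤ Nat.nth Nat.Prime k :=
      fun n k => le_nth_prime_of_count_le
    have h0 := hl 2 0 (by norm_num [Nat.count_succ])
    have h1 := hl 3 1 (by norm_num [Nat.count_succ])
    have h2 := hl 5 2 (by norm_num [Nat.count_succ])
    have h3 := hl 7 3 (by norm_num [Nat.count_succ])
    have h4 := hl 11 4 (by norm_num [Nat.count_succ])
    have h5 := hl 13 5 (by norm_num [Nat.count_succ])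
    have h6 := hl 17 6 (by norm_num [Nat.count_succ])
    have h7 := hl 19 7 (by norm_num [Nat.count_succ])
    have h8 := hl 23 8 (by norm_num [Nat.count_succ])
    have h9 := hl 29 9 (by norm_num [Nat.count_succ])
    have h10 := hl 31 10 (by norm_num [Nat.count_succ])
    have h11 := hl 37 11 (by norm_num [Nat.count_succ])
    have h12 := hl 41 12 (by norm_num [Nat.count_succ])
    have h13 := hl 43 13 (by norm_num [Nat.count_succ])
    have e1 : 2 ≤ ∏ i ∈ Finset.range 1, Nat.nth Nat.Prime i := by simp
    have step : ∀ {a b n c : ℕ}, a ≤ ∏ i ∈ Finset.range n, Nat.nth Nat.Prime i →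
        b ≤ Nat.nth Nat.Prime n → a * b = c →
        c ≤ ∏ i ∈ Finset.range (n + 1), Nat.nth Nat.Prime i := by
      intro a b n c ha hb hc
      rw [Finset.prod_range_succ, ← hc]
      exact Nat.mul_le_mul ha hb
    have e2 := step e1 h1 rfl
    have e3 := step e2 h2 rfl
    have e4 := step e3 h3 rfl
    have e5 := step e4 h4 rfl
    have e6 := step e5 h5 rfl
    have e7 := step e6 h6 rfl
    have e8 := step e7 h7 rfl
    have e9 := step e8 h8 rfl
    have e10 := step e9 h9 rfl
    have e11 := step e10 h10 rfl
    have e12 := step e11 h11 rfl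
    have e13 := step e12 h12 rfl
    have e14 := step e13 h13 rfl
    have fin : ∀ {a k : ℕ}, a ≤ ∏ i ∈ Finset.range k, Nat.nth Nat.Prime i → k ^ k ≤ 2 * a →
        k ^ k ≤ 2 * ∏ i ∈ Finset.range k, Nat.nth Nat.Prime i :=
      fun h1 h2 => h2.trans (Nat.mul_le_mul_left 2 h1)
    intro k hk
    interval_cases k
    · simp
    · exact fin e1 (by norm_num)
    · exact fin e2 (by norm_num)
    · exact fin e3 (by norm_num)
    · exact fin e4 (by norm_num)
    · exact fin e5 (by norm_num)
    · exact fin e6 (by norm_num)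
    · exact fin e7 (by norm_num)
    · exact fin e8 (by norm_num)
    · exact fin e9 (by norm_num)
    · exact fin e10 (by norm_num)
    · exact fin e11 (by norm_num)
    · exact fin e12 (by norm_num)
    · exact fin e13 (by norm_num)
    · exact fin e14 (by norm_num)
  rcases le_total k 14 with hk | hk
  · exact base k hk
  induction k, hk using Nat.le_induction with
  | base => exact base 14 le_rfl
  | succ k hk ih =>
    rw [Finset.prod_range_succ, ← mul_assoc]
    exact (succ_pow_succ_le hk).trans (Nat.mul_le_mul ih (three_mul_sub_one_le_nth_prime hk))

/-- The factor 2 lost against the primorial is recovered from the shape of `D`. If `4 ∣ D`, the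
radical is at most `D / 2`. If `D` is odd, adjoining 2 to its primes gives `k + 1` primes, and the
extra factor of the primorial is at least 4. -/
lemma card_primeFactors_pow_self_le {D : ℕ} (hD : D ≠ 0) (h : Odd D ∨ 4 ∣ D) :
    D.primeFactors.card ^ D.primeFactors.card ≤ D := by
  have hS : ∀ p ∈ D.primeFactors, p.Prime := fun p hp => Nat.prime_of_mem_primeFactors hp
  by_cases hk : D.primeFactors.card < 2
  · have : D.primeFactors.card = 0 ∨ D.primeFactors.card = 1 := by omega
    rcases this with h | h <;> rw [h] <;> omega
  refine (pow_self_le_two_mul_prod_nth_prime _).trans ?_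
  rcases h with h | ⟨e, rfl⟩
  · have h2 : 2 ∉ D.primeFactors := fun h2 =>
      (Nat.not_even_iff_odd.mpr h) (even_iff_two_dvd.mpr (Nat.dvd_of_mem_primeFactors h2))
    have h3 := prod_nth_prime_le_prod (insert 2 D.primeFactors) (by
      intro p hp
      rcases Finset.mem_insert.mp hp with rfl | hp
      exacts [Nat.prime_two, hS p hp])
    rw [Finset.card_insert_of_notMem h2, Finset.prod_range_succ, Finset.prod_insert h2] at h3
    have h4 : 4 ≤ Nat.nth Nat.Prime D.primeFactors.card :=
      le_trans (by omega) (Nat.add_two_le_nth_prime _)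
    have h5 := Nat.le_of_dvd (Nat.pos_of_ne_zero hD) (Nat.prod_primeFactors_dvd D)
    have h6 := Nat.mul_le_mul_left (∏ i ∈ Finset.range D.primeFactors.card, Nat.nth Nat.Prime i) h4
    omega
  · have he : 2 * e ≠ 0 := by omega
    have h1 : (4 * e).primeFactors = (2 * e).primeFactors := by
      rw [show 4 * e = 2 * (2 * e) by ring, Nat.primeFactors_mul two_ne_zero he,
        Nat.primeFactors_mul two_ne_zero (by omega), ← Finset.union_assoc, Finset.union_self]
    have h2 := Nat.le_of_dvd (Nat.pos_of_ne_zero he) (Nat.prod_primeFactors_dvd (2 * e))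
    have h3 := prod_nth_prime_le_prod _ hS
    rw [h1] at h3 ⊢
    omega

/-! ### From `k ^ k ≤ D` to the Lambert function. -/

lemma card_le_exp_lambertW_log {D k : ℕ} (hD : 1 < D) (h : k ^ k ≤ D) :
    (k : ℝ) ≤ Real.exp (lambertW (Real.log D)) := by
  have hlog : 0 < Real.log D := Real.log_pos (by exact_mod_cast hD)
  obtain ⟨h0, hw⟩ := lambertW_spec hlog.le
  by_contra! hlt
  have hk1 : (1 : ℝ) < k := (Real.one_le_exp h0).trans_lt hlt
  have hlk : lambertW (Real.log D) < Real.log k := (Real.lt_log_iff_exp_lt (by linarith)).mpr hlt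
  have h1 : (k : ℝ) * Real.log k ≤ Real.log D := by
    rw [← Real.log_pow]
    exact Real.log_le_log (by positivity) (by exact_mod_cast h)
  have h2 : lambertW (Real.log D) * Real.exp (lambertW (Real.log D)) < Real.log k * k :=
    mul_lt_mul' hlk.le hlt (Real.exp_pos _).le (h0.trans_lt hlk)
  linarith

lemma two_pow_le_rpow_lambertW {D k : ℕ} (hD : 1 < D) (h : k ^ k ≤ D) :
    (2 : ℝ) ^ k ≤ (D : ℝ) ^ (Real.log 2 / lambertW (Real.log D)) := by
  have hlog : 0 < Real.log D := Real.log_pos (by exact_mod_cast hD)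
  obtain ⟨h0, hw⟩ := lambertW_spec hlog.le
  have hpos : 0 < lambertW (Real.log D) := by
    refine h0.lt_of_ne fun h => ?_
    rw [← h, zero_mul] at hw
    exact hlog.ne hw
  have hk := card_le_exp_lambertW_log hD h
  rw [Real.rpow_def_of_pos (by positivity), ← Real.rpow_natCast,
    Real.rpow_def_of_pos two_pos, Real.exp_le_exp]
  have : Real.log D * (Real.log 2 / lambertW (Real.log D)) =
      Real.log 2 * Real.exp (lambertW (Real.log D)) := by
    nth_rewrite 1 [← hw]
    field_simp
  rw [this]
  exact mul_le_mul_of_nonneg_left hk (Real.log_nonneg one_le_two)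

/-! ### 2-torsion and squares in an abelian group. -/

section Group

variable {G ι : Type*} [CommGroup G]

lemma exists_prod_of_mem_closure_image (U : Finset ι) (g : ι → G) (hg : ∀ i ∈ U, g i ^ 2 = 1)
    {x : G} (hx : x ∈ Subgroup.closure (g '' U)) : ∃ S ⊆ U, ∏ i ∈ S, g i = x := by
  classical
  have mul_gen : ∀ i ∈ U, ∀ S ⊆ U, ∃ S' ⊆ U, ∏ j ∈ S', g j = g i * ∏ j ∈ S, g j := by
    intro i hi S hS
    by_cases h : i ∈ S
    · refine ⟨S.erase i, (Finset.erase_subset _ _).trans hS, ?_⟩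
      rw [← Finset.mul_prod_erase S g h, ← mul_assoc, ← sq, hg i hi, one_mul]
    · exact ⟨insert i S, Finset.insert_subset hi hS, Finset.prod_insert h⟩
  induction hx using Subgroup.closure_induction_left with
  | one => exact ⟨∅, Finset.empty_subset _, rfl⟩
  | mul_left y hy z hz ih =>
    obtain ⟨i, hi, rfl⟩ := hy
    obtain ⟨S, hS, rfl⟩ := ih
    exact mul_gen i hi S hS
  | inv_mul_cancel y hy z hz ih =>
    obtain ⟨i, hi, rfl⟩ := hy
    obtain ⟨S, hS, rfl⟩ := ih
    rw [inv_eq_of_mul_eq_one_left (by rw [← sq, hg i hi])]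
    exact mul_gen i hi S hS

lemma natCard_le_two_pow_of_le_closure_image (U : Finset ι) (g : ι → G)
    (hg : ∀ i ∈ U, g i ^ 2 = 1) (H : Subgroup G) (hH : H ≤ Subgroup.closure (g '' U)) :
    Nat.card H ≤ 2 ^ U.card := by
  classical
  choose f hfU hf using fun x : H => exists_prod_of_mem_closure_image U g hg (hH x.2)
  have hinj : Function.Injective fun x : H => (⟨f x, Finset.mem_powerset.mpr (hfU x)⟩ :
      U.powerset) := by
    intro x y hxy
    apply Subtype.ext
    rw [← hf x, ← hf y, Subtype.mk.inj hxy]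
  exact (Nat.card_le_card_of_injective _ hinj).trans_eq
    (by rw [Nat.card_eq_fintype_card, Fintype.card_coe, Finset.card_powerset])

/-- The relation expresses one generator through the others, so `#U - 1` involutions generate the
kernel of squaring; the index of the kernel is the order of the image. -/
lemma two_mul_natCard_le_of_relation [DecidableEq ι] (U T : Finset ι) (g : ι → G)
    (hg : ∀ i ∈ U, g i ^ 2 = 1) (hTU : T ⊆ U) (hT : T.Nonempty) (hrel : ∏ i ∈ T, g i = 1)
    (hgen : ∀ x : G, x ^ 2 = 1 → x ∈ Subgroup.closure (g '' U)) :
    2 * Nat.card G ≤ 2 ^ U.card * Nat.card (powMonoidHom 2 : G →* G).range := by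
  obtain ⟨t, ht⟩ := hT
  have hker : (powMonoidHom 2 : G →* G).ker ≤ Subgroup.closure (g '' (U.erase t)) := by
    intro x hx
    refine (Subgroup.closure_le _).mpr ?_ (hgen x hx)
    rintro _ ⟨i, hi, rfl⟩
    have hmem : ∀ j ∈ U, j ≠ t → g j ∈ Subgroup.closure (g '' (U.erase t)) := fun j hj hjt =>
      Subgroup.subset_closure ⟨j, Finset.mem_erase.mpr ⟨hjt, hj⟩, rfl⟩
    by_cases hit : i = t
    · subst hit
      rw [← Finset.mul_prod_erase T g ht] at hrel
      rw [eq_inv_of_mul_eq_one_left hrel]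
      exact inv_mem (prod_mem fun j hj =>
        hmem j (hTU (Finset.mem_of_mem_erase hj)) (Finset.ne_of_mem_erase hj))
    · exact hmem i hi hit
  have h1 := natCard_le_two_pow_of_le_closure_image (U.erase t) g
    (fun i hi => hg i (Finset.mem_of_mem_erase hi)) _ hker
  have h2 : Nat.card (powMonoidHom 2 : G →* G).ker * Nat.card (powMonoidHom 2 : G →* G).range =
      Nat.card G := by
    rw [← Subgroup.index_ker, Subgroup.card_mul_index]
  rw [← h2, ← mul_assoc, ← Finset.card_erase_add_one (hTU ht), pow_succ']
  gcongr

end Group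

/-! ### Ideals whose square is generated by a natural number. -/

section Ideals

open nonZeroDivisors

variable {R : Type*} [CommRing R]

/-- `(p, e)² = (p², p e, p f) = p (p, e, f)`, and the last ideal is the unit ideal. -/
lemma span_pair_sq {p e f a b c : R} (hef : e ^ 2 = p * f) (h : a * p + b * e + c * f = 1) :
    Ideal.span {p, e} ^ 2 = Ideal.span {p} := by
  rw [sq, Ideal.span_pair_mul_span_pair]
  refine le_antisymm (Ideal.span_le.mpr ?_) (Ideal.span_le.mpr ?_)
  · rintro x (rfl | rfl | rfl | rfl) <;> rw [SetLike.mem_coe, Ideal.mem_span_singleton]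
    · exact dvd_mul_right _ _
    · exact dvd_mul_right _ _
    · exact dvd_mul_left _ _
    · exact ⟨f, by rw [← sq, hef]⟩
  · rintro x rfl
    have hx : x = a * (x * x) + b * (x * e) + c * (e * e) := by
      rw [← sq e, hef]; linear_combination -x * h
    rw [hx, SetLike.mem_coe]
    refine add_mem (add_mem ?_ ?_) ?_ <;>
      exact Ideal.mul_mem_left _ _ (Ideal.subset_span (by simp [← hx]))

lemma span_natAbs (n : ℤ) : Ideal.span {(n.natAbs : R)} = Ideal.span {(n : R)} := by
  rcases Int.natAbs_eq n with h | h
  · conv_rhs => rw [h, Int.cast_natCast]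
  · conv_rhs => rw [h, Int.cast_neg, Int.cast_natCast, Ideal.span_singleton_neg]

variable [IsDedekindDomain R]

lemma natCast_ne_zero_of_sq_eq_span (J : (Ideal R)⁰) {r : ℕ}
    (hJ : (J : Ideal R) ^ 2 = Ideal.span {(r : R)}) : r ≠ 0 := by
  rintro rfl
  rw [Nat.cast_zero, Ideal.span_singleton_zero] at hJ
  exact nonZeroDivisors.ne_zero J.2 (eq_zero_of_pow_eq_zero hJ)

lemma mk0_eq_one_iff_isPrincipal (I : (Ideal R)⁰) :
    ClassGroup.mk0 I = 1 ↔ (I : Ideal R).IsPrincipal := by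
  obtain ⟨I, hI⟩ := I
  exact ClassGroup.mk0_eq_one_iff hI

/-- Descent on `r`: a prime `p ∣ r` in `U` lets `P p` be split off from `J`; any other `p` divides
every element of `J`, so the principal factor `(p)` splits off without changing the class. -/
lemma mk0_mem_closure_of_sq_eq_span_natCast [CharZero R] (U : Set ℕ) (P : ℕ → (Ideal R)⁰)
    (hram : ∀ p ∈ U, (P p : Ideal R) ^ 2 = Ideal.span {(p : R)})
    (hunr : ∀ p : ℕ, p.Prime → p ∉ U → ∀ x : R, (p : R) ∣ x ^ 2 → (p : R) ∣ x)
    (r : ℕ) (hr : r ≠ 0) (J : (Ideal R)⁰) (hJ : (J : Ideal R) ^ 2 = Ideal.span {(r : R)}) :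
    ClassGroup.mk0 J ∈ Subgroup.closure ((fun p => ClassGroup.mk0 (P p)) '' U) := by
  induction r using Nat.strong_induction_on generalizing J with
  | _ r ih =>
  by_cases h1 : r = 1
  · have : (J : Ideal R) = ⊤ := by
      rw [h1, Nat.cast_one, Ideal.span_singleton_one] at hJ
      exact Ideal.eq_top_of_isUnit_mem _ ((Ideal.pow_le_self two_ne_zero) (hJ ▸ Submodule.mem_top))
        isUnit_one
    have h2 : ClassGroup.mk0 J = 1 := by
      rw [show J = 1 from Subtype.ext (by simpa using this), map_one]
    exact h2 ▸ one_mem _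
  obtain ⟨p, hp, k, rfl⟩ := Nat.exists_prime_and_dvd h1
  have hk : k ≠ 0 := by rintro rfl; exact hr (mul_zero _)
  have hpR : (p : R) ≠ 0 := Nat.cast_ne_zero.mpr hp.ne_zero
  have hkp : k < p * k := lt_mul_of_one_lt_left (Nat.pos_of_ne_zero hk) hp.one_lt
  rw [Nat.cast_mul, ← Ideal.span_singleton_mul_span_singleton] at hJ
  have hspan : Ideal.span {(p : R)} ≠ 0 := by simpa [Ideal.zero_eq_bot] using hpR
  by_cases hpU : p ∈ U
  · rw [← hram p hpU] at hJ
    obtain ⟨I, hI⟩ := (UniqueFactorizationMonoid.pow_dvd_pow_iff_dvd two_ne_zero).mp (Dvd.intro _ hJ.symm)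
    have hI0 : I ∈ (Ideal R)⁰ := by
      refine mem_nonZeroDivisors_of_ne_zero ?_
      rintro rfl
      exact nonZeroDivisors.ne_zero J.2 (by rw [hI, mul_zero])
    have hsq : I ^ 2 = Ideal.span {(k : R)} := by
      rw [hI, mul_pow, hram p hpU] at hJ
      exact mul_left_cancel₀ hspan hJ
    have hJI : J = P p * ⟨I, hI0⟩ := Subtype.ext hI
    rw [hJI, map_mul]
    exact mul_mem (Subgroup.subset_closure ⟨p, hpU, rfl⟩) (ih k hkp hk ⟨I, hI0⟩ hsq)
  · have hdvd : Ideal.span {(p : R)} ∣ (J : Ideal R) := by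
      rw [Ideal.dvd_iff_le]
      intro x hx
      rw [Ideal.mem_span_singleton]
      refine hunr p hp hpU x ?_
      rw [← Ideal.mem_span_singleton]
      have hx2 := Ideal.pow_mem_pow hx 2
      rw [hJ] at hx2
      have hle : Ideal.span {(p : R)} * Ideal.span {(k : R)} ≤ Ideal.span {(p : R)} :=
        Ideal.mul_le_left
      exact hle hx2
    obtain ⟨I, hI⟩ := hdvd
    have hI0 : I ∈ (Ideal R)⁰ := by
      refine mem_nonZeroDivisors_of_ne_zero ?_
      rintro rfl
      exact nonZeroDivisors.ne_zero J.2 (by rw [hI, mul_zero])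
    have hsq : Ideal.span {(p : R)} * I ^ 2 = Ideal.span {(k : R)} := by
      rw [hI, mul_pow, sq, mul_assoc] at hJ
      exact mul_left_cancel₀ hspan hJ
    have hJI : ClassGroup.mk0 J = ClassGroup.mk0 ⟨I, hI0⟩ :=
      ClassGroup.mk0_eq_mk0_iff.mpr ⟨1, p, one_ne_zero, hpR, by simp [hI]⟩
    rw [hJI]
    by_cases hpk : p ∣ k
    · obtain ⟨l, rfl⟩ := hpk
      have hl : l ≠ 0 := by rintro rfl; exact hk (mul_zero _)
      refine ih l ((lt_mul_of_one_lt_left (Nat.pos_of_ne_zero hl) hp.one_lt).trans hkp) hl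
        ⟨I, hI0⟩ ?_
      rw [Nat.cast_mul, ← Ideal.span_singleton_mul_span_singleton] at hsq
      exact mul_left_cancel₀ hspan hsq
    -- Now `p * I ^ 2 = (k)` with `p` prime to `k` forces `p` to be a unit, which a general `R` does
    -- not exclude.
    · have htop : Ideal.span {(p : R)} = ⊤ := by
        obtain ⟨a, b, hab⟩ : IsCoprime (p : R) (k : R) := by
          have := ((Nat.Prime.coprime_iff_not_dvd hp).mpr hpk).isCoprime.map (Int.castRingHom R)
          simpa using this
        rw [Ideal.eq_top_iff_one, ← hab]
        refine add_mem (Ideal.mul_mem_left _ _ (Ideal.mem_span_singleton_self _))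
          (Ideal.mul_mem_left _ _ ?_)
        have hk := Ideal.mem_span_singleton_self (k : R)
        rw [← hsq] at hk
        have hle : Ideal.span {(p : R)} * I ^ 2 ≤ Ideal.span {(p : R)} := Ideal.mul_le_left
        exact hle hk
      refine ih k hkp hk ⟨I, hI0⟩ ?_
      rwa [htop, Ideal.top_mul] at hsq

end Ideals

/-! ### Bounding the 2-torsion of a class group. -/

section NumberField

open nonZeroDivisors

variable {K : Type*} [Field K] [NumberField K]

/-- An explicit form of Hilbert 90. If `I² = (a)` and `n = N(I)`, then `a a' = n²`, so `a (a' + n)²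
= n² (a + a' + 2 n)` is a rational integer; multiply `I` by `(a' + n)`. -/
lemma exists_mk0_eq_sq_eq_span_natCast
    (hconj : ∀ a : 𝓞 K, ∃ (a' : 𝓞 K) (t : ℤ),
      a + a' = t ∧ a * a' = (Ideal.absNorm (Ideal.span {a}) : 𝓞 K))
    (c : ClassGroup (𝓞 K)) (hc : c ^ 2 = 1) :
    ∃ (J : (Ideal (𝓞 K))⁰) (r : ℕ), r ≠ 0 ∧ ClassGroup.mk0 J = c ∧
      (J : Ideal (𝓞 K)) ^ 2 = Ideal.span {(r : 𝓞 K)} := by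
  obtain ⟨I, rfl⟩ := ClassGroup.mk0_surjective c
  have hI0 : (I : Ideal (𝓞 K)) ≠ ⊥ := nonZeroDivisors.ne_zero I.2
  obtain ⟨a, ha⟩ : ((I : Ideal (𝓞 K)) ^ 2).IsPrincipal := by
    rw [← map_pow] at hc
    exact by
      have := (mk0_eq_one_iff_isPrincipal _).mp hc
      rwa [SubmonoidClass.coe_pow] at this
  rw [Ideal.submodule_span_eq] at ha
  obtain ⟨a', t, hadd, hmul⟩ := hconj a
  set n := Ideal.absNorm (I : Ideal (𝓞 K)) with hn
  have hn0 : n ≠ 0 := by simpa [hn, Ideal.absNorm_eq_zero_iff] using hI0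
  rw [← ha, map_pow, ← hn, Nat.cast_pow] at hmul
  -- The multiplier must be nonzero; if it vanishes, `a = -n` and `I` itself serves.
  by_cases hb : a' + n = 0
  · have hn0' : (n : 𝓞 K) ≠ 0 := Nat.cast_ne_zero.mpr hn0
    have han : a = -n := by
      rw [eq_neg_of_add_eq_zero_left hb] at hmul
      refine mul_right_cancel₀ hn0' ?_
      linear_combination -hmul
    refine ⟨I, n, hn0, rfl, ?_⟩
    rw [ha, han, Ideal.span_singleton_neg]
  · obtain ⟨B, hB⟩ : ∃ B : (Ideal (𝓞 K))⁰, (B : Ideal (𝓞 K)) = Ideal.span {a' + (n : 𝓞 K)} :=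
      ⟨⟨Ideal.span {a' + (n : 𝓞 K)},
        mem_nonZeroDivisors_of_ne_zero (mt Ideal.span_singleton_eq_bot.mp hb)⟩, rfl⟩
    have hB1 : ClassGroup.mk0 B = 1 := (mk0_eq_one_iff_isPrincipal B).mpr ⟨_, hB⟩
    have hJ : ((I * B : (Ideal (𝓞 K))⁰) : Ideal (𝓞 K)) ^ 2 =
        Ideal.span {(((n * (n * (t + 2 * n)) : ℤ).natAbs : ℕ) : 𝓞 K)} := by
      rw [span_natAbs, Submonoid.coe_mul, mul_pow, ha, hB, Ideal.span_singleton_pow,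
        Ideal.span_singleton_mul_span_singleton]
      congr 2
      push_cast
      rw [← hadd]
      linear_combination (a' + 2 * n) * hmul
    exact ⟨I * B, _, natCast_ne_zero_of_sq_eq_span _ hJ, by rw [map_mul, hB1, mul_one], hJ⟩

/-- Genus theory bound: if every rational prime outside the finite set `U` is unramified, every
prime in `U` is a square of an ideal, and some nonempty product of these ideals is principal, then
the `2`-torsion of the class group has order at most `2 ^ (#U - 1)`. -/
lemma two_mul_natCard_classGroup_le (U T : Finset ℕ) (P : ℕ → (Ideal (𝓞 K))⁰)
    (hconj : ∀ a : 𝓞 K, ∃ (a' : 𝓞 K) (t : ℤ),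
      a + a' = t ∧ a * a' = (Ideal.absNorm (Ideal.span {a}) : 𝓞 K))
    (hram : ∀ p ∈ U, (P p : Ideal (𝓞 K)) ^ 2 = Ideal.span {(p : 𝓞 K)})
    (hunr : ∀ p : ℕ, p.Prime → p ∉ U → ∀ x : 𝓞 K, (p : 𝓞 K) ∣ x ^ 2 → (p : 𝓞 K) ∣ x)
    (hTU : T ⊆ U) (hT : T.Nonempty) {y : 𝓞 K}
    (hy : Ideal.span {y} ^ 2 = Ideal.span {((∏ p ∈ T, p : ℕ) : 𝓞 K)}) :
    2 * Nat.card (ClassGroup (𝓞 K)) ≤ 2 ^ U.card *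
      Nat.card (powMonoidHom 2 : ClassGroup (𝓞 K) →* ClassGroup (𝓞 K)).range := by
  refine two_mul_natCard_le_of_relation U T (fun p => ClassGroup.mk0 (P p)) ?_ hTU hT ?_ ?_
  · intro p hp
    rw [← map_pow]
    refine (mk0_eq_one_iff_isPrincipal _).mpr ?_
    rw [SubmonoidClass.coe_pow, hram p hp]
    exact ⟨_, rfl⟩
  · rw [← map_prod]
    refine (mk0_eq_one_iff_isPrincipal _).mpr ⟨y, ?_⟩
    rw [Ideal.submodule_span_eq]
    have h : ((∏ p ∈ T, P p : (Ideal (𝓞 K))⁰) : Ideal (𝓞 K)) ^ 2 = Ideal.span {y} ^ 2 := by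
      rw [hy, Submonoid.coe_finsetProd, ← Finset.prod_pow,
        Finset.prod_congr rfl fun p hp => hram p (hTU hp), Ideal.prod_span_singleton,
        Nat.cast_prod]
    exact le_antisymm
      (Ideal.dvd_iff_le.mp ((UniqueFactorizationMonoid.pow_dvd_pow_iff_dvd two_ne_zero).mp h.symm.dvd))
      (Ideal.dvd_iff_le.mp ((UniqueFactorizationMonoid.pow_dvd_pow_iff_dvd two_ne_zero).mp h.dvd))
  · intro x hx
    obtain ⟨J, r, hr, rfl, hJ⟩ := exists_mk0_eq_sq_eq_span_natCast hconj x hx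
    exact mk0_mem_closure_of_sq_eq_span_natCast (U : Set ℕ) P hram
      (fun p hp hpU => hunr p hp hpU) r hr J hJ

end NumberField

open ComplexConjugate

/-! ### Traces, norms and unramified primes in imaginary quadratic fields. -/

lemma exists_intCast_eq_of_squarefree {m N : ℤ} (hm : Squarefree m) {q : ℚ}
    (h : q ^ 2 * m = N) : ∃ g : ℤ, (g : ℚ) = q := by
  have hden : (q.den : ℚ) ≠ 0 := Nat.cast_ne_zero.mpr q.den_ne_zero
  have h1 : q.num ^ 2 * m = N * (q.den : ℤ) ^ 2 := by
    have h2 : (q.num : ℚ) = q * q.den := (Rat.mul_den_eq_num q).symm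
    have h3 : ((q.num ^ 2 * m : ℤ) : ℚ) = ((N * (q.den : ℤ) ^ 2 : ℤ) : ℚ) := by
      push_cast
      rw [h2, ← h]
      ring
    exact_mod_cast h3
  have hcop : IsCoprime ((q.den : ℤ) ^ 2) (q.num ^ 2) :=
    (Int.isCoprime_iff_nat_coprime.mpr (by simpa using q.reduced.symm)).pow
  have hdvd : (q.den : ℤ) * q.den ∣ m := by
    rw [← sq]
    exact hcop.dvd_of_dvd_mul_left ⟨N, by rw [h1, mul_comm]⟩
  have hunit := hm _ hdvd
  have hd1 : q.den = 1 := by simpa [Int.isUnit_iff_natAbs_eq] using hunit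
  exact ⟨q.num, Rat.coe_int_num_of_den_eq_one hd1⟩

/-- For odd `p`, both `t` and `g` are divisible by `p`, hence `p² ∣ 4 n`. For `p = 2`, halving `t`
and `g` leaves two numbers of equal parity, and `m ≡ 1 (mod 4)` makes `t² - m g²` divisible by 4. -/
lemma sq_dvd_of_dvd_of_sq_sub {m t n g : ℤ} {p : ℕ} (hp : p.Prime) (hpm : ¬ (p : ℤ) ∣ m)
    (h2 : p = 2 → m % 4 = 1) (ht : (p : ℤ) ∣ t) (hn : (p : ℤ) ∣ n)
    (h : t ^ 2 - 4 * n = m * g ^ 2) : (p : ℤ) ^ 2 ∣ n := by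
  have hp' : Prime (p : ℤ) := Nat.prime_iff_prime_int.mp hp
  obtain ⟨t, rfl⟩ := ht
  have hg : (p : ℤ) ∣ g := by
    have h3 : (p : ℤ) ∣ m * g ^ 2 := by
      rw [← h]
      exact dvd_sub ((dvd_mul_right _ _).pow two_ne_zero) (hn.mul_left 4)
    exact hp'.dvd_of_dvd_pow ((hp'.dvd_or_dvd h3).resolve_left hpm)
  obtain ⟨g, rfl⟩ := hg
  by_cases hp2 : p = 2
  · subst hp2
    obtain ⟨k, rfl⟩ := hn
    have hm1 := h2 rfl
    obtain ⟨l, rfl⟩ : ∃ l, m = 4 * l + 1 := ⟨m / 4, by omega⟩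
    have h4 : 2 * k = t ^ 2 - (4 * l + 1) * g ^ 2 := by
      push_cast at h; linarith
    have hev : Even (t ^ 2 - g ^ 2) := ⟨k + 2 * l * g ^ 2, by linear_combination -h4⟩
    rw [Int.even_sub, Int.even_pow' two_ne_zero, Int.even_pow' two_ne_zero, ← Int.even_sub] at hev
    obtain ⟨j, hj⟩ := hev
    refine ⟨g * j + j ^ 2 - l * g ^ 2, ?_⟩
    push_cast
    rw [h4, sub_eq_iff_eq_add.mp hj]
    ring
  · have hcop : IsCoprime ((p : ℤ) ^ 2) 4 := by
      have : IsCoprime (p : ℤ) (2 : ℕ) :=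
        Nat.isCoprime_iff_coprime.mpr ((Nat.coprime_primes hp Nat.prime_two).mpr hp2)
      simpa using this.pow (m := 2) (n := 2)
    refine hcop.dvd_of_dvd_mul_left ⟨t ^ 2 - m * g ^ 2, ?_⟩
    linear_combination -h

lemma norm_eq_mul_conj {F : Type*} [Field F] [NumberField F] {m : ℤ} {S : F} (hS : S ^ 2 = m)
    (f : F →+* ℂ) (hS0 : f S ≠ 0) (hconj : conj (f S) = -f S)
    (hF : ∀ y : F, ∃ u v : ℚ, y = u + v * S) (x : F) :
    ((Algebra.norm ℚ x : ℚ) : ℂ) = f x * conj (f x) := by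
  classical
  set c : F →+* ℂ := (starRingEnd ℂ).comp f with hc
  have hne : f.toRatAlgHom ≠ c.toRatAlgHom := by
    intro h
    have h1 : f S = c S := DFunLike.congr_fun h S
    rw [hc, RingHom.comp_apply, hconj] at h1
    exact hS0 (self_eq_neg.mp h1)
  have huniv : (Finset.univ : Finset (F →ₐ[ℚ] ℂ)) = {f.toRatAlgHom, c.toRatAlgHom} := by
    refine (Finset.eq_univ_iff_forall.mpr fun σ => ?_).symm
    have hext : ∀ τ : F →ₐ[ℚ] ℂ, σ S = τ S → σ = τ := by
      intro τ h
      ext y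
      obtain ⟨u, v, rfl⟩ := hF y
      simp only [map_add, map_mul, map_ratCast, h]
    have hσ : σ S ^ 2 = f S ^ 2 := by
      rw [← map_pow, ← map_pow, hS, map_intCast, map_intCast]
    rw [Finset.mem_insert, Finset.mem_singleton]
    rcases sq_eq_sq_iff_eq_or_eq_neg.mp hσ with h | h
    · exact Or.inl (hext _ h)
    · exact Or.inr (hext _ (h.trans hconj.symm))
  have h := Algebra.norm_eq_prod_embeddings ℚ ℂ x
  rw [huniv, Finset.prod_pair hne] at h
  exact h

section Field

variable {K : IntermediateField ℚ ℂ} {m : ℤ} {s : ℂ}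

lemma exists_trace_norm (hm : Squarefree m) (hs2 : s ^ 2 = m) (hconj : conj s = -s)
    (hK : ∀ x ∈ K, ∃ u v : ℚ, x = u + v * s) (x : 𝓞 K) :
    ∃ t n g : ℤ, ((x : K) : ℂ) + conj ((x : K) : ℂ) = t ∧
      ((x : K) : ℂ) * conj ((x : K) : ℂ) = n ∧ t ^ 2 - 4 * n = m * g ^ 2 := by
  obtain ⟨u, v, huv⟩ := hK _ (x : K).2
  have hx : IsIntegral ℤ ((x : K) : ℂ) := x.isIntegral_coe.algebraMap
  have hx' : IsIntegral ℤ (conj ((x : K) : ℂ)) := hx.map (starRingEnd ℂ).toIntAlgHom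
  have key : ∀ q : ℚ, IsIntegral ℤ (q : ℂ) → ∃ k : ℤ, (k : ℚ) = q := fun q hq =>
    IsIntegrallyClosed.isIntegral_iff.mp
      ((isIntegral_algebraMap_iff (A := ℚ) (B := ℂ) (algebraMap ℚ ℂ).injective).mp hq)
  have hcx : conj ((x : K) : ℂ) = u - v * s := by
    rw [huv]; simp [hconj]; ring
  have hadd : ((x : K) : ℂ) + conj ((x : K) : ℂ) = ((2 * u : ℚ) : ℂ) := by
    rw [hcx, huv]; push_cast; ring
  have hmul : ((x : K) : ℂ) * conj ((x : K) : ℂ) = ((u ^ 2 - m * v ^ 2 : ℚ) : ℂ) := by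
    rw [hcx, huv]; push_cast; linear_combination - v ^ 2 * hs2
  obtain ⟨t, ht⟩ := key _ (hadd ▸ hx.add hx')
  obtain ⟨n, hn⟩ := key _ (hmul ▸ hx.mul hx')
  have hg : (2 * v) ^ 2 * m = ((t ^ 2 - 4 * n : ℤ) : ℚ) := by
    push_cast; rw [ht, hn]; ring
  obtain ⟨g, hg'⟩ := exists_intCast_eq_of_squarefree hm hg
  refine ⟨t, n, g, by rw [hadd, ← ht]; simp, by rw [hmul, ← hn]; simp, ?_⟩
  rw [← hg'] at hg
  have : (((g ^ 2 * m : ℤ)) : ℚ) = ((t ^ 2 - 4 * n : ℤ) : ℚ) := by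
    rw [← hg]; push_cast; ring
  rw [← Int.cast_injective this]; ring

lemma coe_norm_eq_mul_conj [NumberField K] (hs : s ∈ K) (hs0 : s ≠ 0) (hs2 : s ^ 2 = m)
    (hconj : conj s = -s) (hK : ∀ x ∈ K, ∃ u v : ℚ, x = u + v * s) (x : K) :
    ((Algebra.norm ℚ x : ℚ) : ℂ) = (x : ℂ) * conj (x : ℂ) := by
  refine norm_eq_mul_conj (S := (⟨s, hs⟩ : K)) (Subtype.ext (by simpa using hs2))
    (algebraMap K ℂ) hs0 hconj (fun y => ?_) x
  obtain ⟨u, v, h⟩ := hK _ y.2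
  exact ⟨u, v, Subtype.ext (by simpa using h)⟩

/-- The conjugate is integral, being trace minus `a`; the norm is `|a|² ≥ 0`, so it equals the ideal
norm without a sign. -/
lemma exists_conj_absNorm [NumberField K] (hm : Squarefree m) (hs : s ∈ K) (hs0 : s ≠ 0)
    (hs2 : s ^ 2 = m) (hconj : conj s = -s) (hK : ∀ x ∈ K, ∃ u v : ℚ, x = u + v * s) (a : 𝓞 K) :
    ∃ (a' : 𝓞 K) (t : ℤ), a + a' = t ∧ a * a' = (Ideal.absNorm (Ideal.span {a}) : 𝓞 K) := by
  obtain ⟨t, n, -, hadd, hmul, -⟩ := exists_trace_norm hm hs2 hconj hK a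
  refine ⟨t - a, t, by ring, ?_⟩
  have hnorm : Algebra.norm ℤ a = n := by
    have h := coe_norm_eq_mul_conj hs hs0 hs2 hconj hK (a : K)
    rw [hmul, ← Algebra.coe_norm_int] at h
    exact_mod_cast h
  have hn0 : 0 ≤ n := by
    rw [Complex.mul_conj] at hmul
    have h : Complex.normSq ((a : K) : ℂ) = n := by exact_mod_cast hmul
    have h2 := Complex.normSq_nonneg ((a : K) : ℂ)
    rw [h] at h2
    exact_mod_cast h2
  rw [Ideal.absNorm_span_singleton, hnorm, ← Int.cast_natCast, Int.natAbs_of_nonneg hn0]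
  apply NumberField.RingOfIntegers.ext
  apply Subtype.ext
  have hcast : ∀ k : ℤ, (((k : 𝓞 K) : K) : ℂ) = k := fun k => by simp
  simp only [map_mul, map_sub, hcast, IntermediateField.coe_mul, AddSubgroupClass.coe_sub]
  rw [← hmul, ← hadd]
  ring

/-- From `x² = p y`, taking norms and traces gives `p ∣ n` and `p ∣ t`, then `p² ∣ n`; so `x / p`
has integral trace and norm. -/
lemma dvd_of_dvd_sq_of_unramified [NumberField K] (hm : Squarefree m) (hs2 : s ^ 2 = m)
    (hconj : conj s = -s) (hK : ∀ x ∈ K, ∃ u v : ℚ, x = u + v * s) {p : ℕ} (hp : p.Prime)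
    (hpm : ¬ (p : ℤ) ∣ m) (h2 : p = 2 → m % 4 = 1) (x : 𝓞 K) (hx : (p : 𝓞 K) ∣ x ^ 2) :
    (p : 𝓞 K) ∣ x := by
  obtain ⟨y, hy⟩ := hx
  obtain ⟨t, n, g, hadd, hmul, hg⟩ := exists_trace_norm hm hs2 hconj hK x
  obtain ⟨t', n', -, hadd', hmul', -⟩ := exists_trace_norm hm hs2 hconj hK y
  have hp' : Prime (p : ℤ) := Nat.prime_iff_prime_int.mp hp
  have hyC : ((x : K) : ℂ) ^ 2 = p * ((y : K) : ℂ) := by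
    have := congrArg (fun z : 𝓞 K => ((z : K) : ℂ)) hy
    simpa using this
  have hyC' : conj ((x : K) : ℂ) ^ 2 = p * conj ((y : K) : ℂ) := by
    have := congrArg conj hyC
    simpa using this
  have hn : (p : ℤ) ∣ n := by
    refine hp'.dvd_of_dvd_pow (n := 2) ⟨p * n', ?_⟩
    have : (n : ℂ) ^ 2 = p * (p * n') := by
      rw [← hmul, ← hmul', mul_pow, hyC, hyC']; ring
    exact_mod_cast this
  have ht : (p : ℤ) ∣ t := by
    refine hp'.dvd_of_dvd_pow (n := 2) ?_
    have : (t : ℂ) ^ 2 = p * t' + 2 * n := by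
      rw [← hmul, ← hadd', ← hadd]
      linear_combination hyC + hyC'
    have h3 : t ^ 2 = p * t' + 2 * n := by exact_mod_cast this
    rw [h3]
    exact dvd_add (dvd_mul_right _ _) (hn.mul_left 2)
  obtain ⟨b, hb⟩ := sq_dvd_of_dvd_of_sq_sub hp hpm h2 ht hn hg
  obtain ⟨a, ha⟩ := ht
  have hpK : (p : K) ≠ 0 := Nat.cast_ne_zero.mpr hp.ne_zero
  have hxeq : (x : K) ^ 2 = p * a * x - p ^ 2 * b := by
    apply Subtype.ext
    have ha' : (t : ℂ) = p * a := by exact_mod_cast ha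
    have hb' : (n : ℂ) = p ^ 2 * b := by exact_mod_cast hb
    push_cast
    rw [← ha', ← hb', ← hadd, ← hmul]
    ring
  have hint : IsIntegral ℤ ((x : K) / p) := by
    refine ⟨Polynomial.X ^ 2 - Polynomial.C a * Polynomial.X + Polynomial.C b, ?_, ?_⟩
    · monicity!
    · simp only [Polynomial.eval₂_add, Polynomial.eval₂_sub, Polynomial.eval₂_mul,
        Polynomial.eval₂_pow, Polynomial.eval₂_X, Polynomial.eval₂_C]
      rw [eq_intCast, eq_intCast, div_pow, hxeq]
      field_simp
      ring
  refine ⟨⟨(x : K) / p, hint⟩, NumberField.RingOfIntegers.ext ?_⟩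
  change (x : K) = algebraMap (𝓞 K) K p * ((x : K) / p)
  rw [map_natCast]
  exact (mul_div_cancel₀ _ hpK).symm

end Field

open nonZeroDivisors

/-! ### Ramified primes as squares of ideals. -/

section Ramified

variable {R : Type*} [CommRing R] {m : ℤ} {S : R}

lemma exists_sq_eq_span_of_dvd (hm : Squarefree m) (hS : S ^ 2 = m) {p : ℕ} (hp : p.Prime)
    (hpm : (p : ℤ) ∣ m) : ∃ I : Ideal R, I ^ 2 = Ideal.span {(p : R)} := by
  obtain ⟨k, rfl⟩ := hpm
  have hpk : ¬ (p : ℤ) ∣ k := by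
    rintro ⟨l, rfl⟩
    have h := hm p ⟨l, by ring⟩
    exact (Nat.prime_iff_prime_int.mp hp).not_isUnit h
  obtain ⟨a, c, hac⟩ := (Prime.coprime_iff_not_dvd (Nat.prime_iff_prime_int.mp hp)).mpr hpk
  refine ⟨_, span_pair_sq (e := S) (f := k) (a := a) (b := 0) (c := c) ?_ ?_⟩
  · rw [hS]; push_cast; ring
  · have h : ((a * p + c * k : ℤ) : R) = ((1 : ℤ) : R) := by rw [hac]
    push_cast at h
    linear_combination h

lemma exists_sq_eq_span_two (hm : m % 4 = 3) (hS : S ^ 2 = m) :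
    ∃ I : Ideal R, I ^ 2 = Ideal.span {((2 : ℕ) : R)} := by
  obtain ⟨l, rfl⟩ : ∃ l, m = 4 * l + 3 := ⟨m / 4, by omega⟩
  -- The ideal is `(2, 1 + √m)`, with `(1 + √m)² = 2 (2 l + 2 + √m)`.
  refine ⟨_, span_pair_sq (e := 1 + S) (f := 2 * l + 2 + S) (a := l + 1) (b := 1) (c := -1) ?_ ?_⟩
  · push_cast at hS ⊢
    linear_combination hS
  · push_cast
    ring

end Ramified

/-! ### The genus bound for `ℚ(√-D)`. -/

lemma two_mul_natCard_classGroup_le_of_sqrt {K : IntermediateField ℚ ℂ} [NumberField K] {m : ℤ}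
    {s : ℂ} {D : ℕ} (hm : Squarefree m) (hm0 : m < 0)
    (hD : (m % 4 = 1 ∧ (D : ℤ) = -m) ∨ ((m % 4 = 2 ∨ m % 4 = 3) ∧ (D : ℤ) = -(4 * m)))
    (hs : s ∈ K) (hs2 : s ^ 2 = m) (hconj : conj s = -s)
    (hK : ∀ x ∈ K, ∃ u v : ℚ, x = u + v * s) :
    2 * Nat.card (ClassGroup (𝓞 K)) ≤ 2 ^ D.primeFactors.card *
      Nat.card (powMonoidHom 2 : ClassGroup (𝓞 K) →* ClassGroup (𝓞 K)).range := by
  classical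
  have hs0 : s ≠ 0 := by
    rintro rfl
    have : (m : ℂ) = 0 := by rw [← hs2]; simp
    exact hm0.ne (by exact_mod_cast this)
  have hD0 : D ≠ 0 := by omega
  obtain ⟨S, hS⟩ : ∃ S : 𝓞 K, S ^ 2 = m := by
    have hint : IsIntegral ℤ (⟨s, hs⟩ : K) := by
      refine .of_pow two_pos ?_
      rw [show (⟨s, hs⟩ : K) ^ 2 = algebraMap ℤ K m from Subtype.ext (by simpa using hs2)]
      exact isIntegral_algebraMap
    obtain ⟨S, hS⟩ : ∃ S : 𝓞 K, algebraMap (𝓞 K) K S = ⟨s, hs⟩ := ⟨⟨_, hint⟩, rfl⟩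
    refine ⟨S, NumberField.RingOfIntegers.ext ?_⟩
    change algebraMap (𝓞 K) K (S ^ 2) = algebraMap (𝓞 K) K m
    rw [map_pow, map_intCast, hS]
    exact Subtype.ext (by simpa using hs2)
  have hunr : ∀ p : ℕ, p.Prime → p ∉ D.primeFactors → ∀ x : 𝓞 K,
      (p : 𝓞 K) ∣ x ^ 2 → (p : 𝓞 K) ∣ x := by
    intro p hp hpD
    have hpD' : ¬ (p : ℤ) ∣ D := fun h =>
      hpD (Nat.mem_primeFactors.mpr ⟨hp, Int.natCast_dvd_natCast.mp h, hD0⟩)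
    refine dvd_of_dvd_sq_of_unramified hm hs2 hconj hK hp ?_ ?_
    · intro h
      rcases hD with ⟨-, h1⟩ | ⟨-, h1⟩
      · exact hpD' (h1 ▸ (dvd_neg.mpr h))
      · exact hpD' (h1 ▸ (dvd_neg.mpr (h.mul_left 4)))
    · rintro rfl
      rcases hD with h1 | ⟨-, h1⟩
      · exact h1.1
      · exact absurd (h1 ▸ ⟨-(2 * m), by push_cast; ring⟩) hpD'
  have hram : ∀ p ∈ D.primeFactors, ∃ I : (Ideal (𝓞 K))⁰,
      (I : Ideal (𝓞 K)) ^ 2 = Ideal.span {(p : 𝓞 K)} := by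
    intro p hpD
    obtain ⟨hp, hdvd, -⟩ := Nat.mem_primeFactors.mp hpD
    obtain ⟨I, hI⟩ : ∃ I : Ideal (𝓞 K), I ^ 2 = Ideal.span {(p : 𝓞 K)} := by
      by_cases hpm : (p : ℤ) ∣ m
      · exact exists_sq_eq_span_of_dvd hm hS hp hpm
      · have hdvd' : (p : ℤ) ∣ D := Int.natCast_dvd_natCast.mpr hdvd
        rcases hD with ⟨-, h1⟩ | ⟨h2, h1⟩
        · rw [h1, dvd_neg] at hdvd'
          exact absurd hdvd' hpm
        · rw [h1, dvd_neg] at hdvd'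
          have hp' := Nat.prime_iff_prime_int.mp hp
          have h4 : (p : ℤ) ∣ 2 ^ 2 := (hp'.dvd_or_dvd hdvd').resolve_right hpm
          have hp2 : p = 2 := (Nat.prime_dvd_prime_iff_eq hp Nat.prime_two).mp
            (by exact_mod_cast hp'.dvd_of_dvd_pow h4)
          subst hp2
          refine exists_sq_eq_span_two ?_ hS
          push_cast at hpm
          omega
    refine ⟨⟨I, mem_nonZeroDivisors_of_ne_zero ?_⟩, hI⟩
    rintro rfl
    rw [zero_pow two_ne_zero, eq_comm] at hI
    exact hp.ne_zero (Nat.cast_eq_zero.mp (Ideal.span_singleton_eq_bot.mp hI))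
  choose! P hP using hram
  have hconj' := exists_conj_absNorm hm hs hs0 hs2 hconj hK
  -- Here `√m` is a unit and gives only the empty relation; `(1 + i)² = 2 i` supplies one at the
  -- prime 2.
  by_cases hm1 : m = -1
  · subst hm1
    have h2 : 2 ∈ D.primeFactors := by
      refine Nat.mem_primeFactors.mpr ⟨Nat.prime_two, ?_, hD0⟩
      omega
    refine two_mul_natCard_classGroup_le D.primeFactors {2} P hconj' hP hunr
      (Finset.singleton_subset_iff.mpr h2) (Finset.singleton_nonempty 2) (y := 1 + S) ?_
    have hu : IsUnit S := IsUnit.of_mul_eq_one (-S) (by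
      push_cast at hS
      linear_combination -hS)
    rw [Ideal.span_singleton_pow, Finset.prod_singleton,
      ← Ideal.span_singleton_mul_right_unit hu ((2 : ℕ) : 𝓞 K)]
    congr 2
    push_cast at hS ⊢
    linear_combination hS
  · refine two_mul_natCard_classGroup_le D.primeFactors m.natAbs.primeFactors P hconj' hP hunr
      (Nat.primeFactors_mono ?_ hD0) (Nat.nonempty_primeFactors.mpr (by omega)) (y := S) ?_
    · rw [← Int.natCast_dvd_natCast, Int.natAbs_dvd]
      rcases hD with ⟨-, h1⟩ | ⟨-, h1⟩ <;> rw [h1, dvd_neg]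
      exact Dvd.intro_left 4 rfl
    · rw [Nat.prod_primeFactors_of_squarefree (Int.squarefree_natAbs.mpr hm), span_natAbs,
        Ideal.span_singleton_pow, hS]

lemma exists_eq_add_mul_of_mem_adjoin {m : ℤ} (hm0 : m < 0) {s : ℂ} (hs2 : s ^ 2 = m) {x : ℂ}
    (hx : x ∈ IntermediateField.adjoin ℚ {s}) : ∃ u v : ℚ, x = u + v * s := by
  induction hx using IntermediateField.adjoin_induction with
  | mem x hx => exact ⟨0, 1, by simpa using hx⟩
  | algebraMap q => exact ⟨q, 0, by simp⟩
  | add x y _ _ hx hy =>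
    obtain ⟨u, v, rfl⟩ := hx
    obtain ⟨u', v', rfl⟩ := hy
    exact ⟨u + u', v + v', by push_cast; ring⟩
  | mul x y _ _ hx hy =>
    obtain ⟨u, v, rfl⟩ := hx
    obtain ⟨u', v', rfl⟩ := hy
    exact ⟨u * u' + m * v * v', u * v' + v * u', by
      push_cast; linear_combination v * v' * hs2⟩
  | inv x _ hx =>
    obtain ⟨u, v, rfl⟩ := hx
    by_cases h : u ^ 2 - m * v ^ 2 = 0
    · have hm' : (m : ℚ) < 0 := by exact_mod_cast hm0
      have hu : u = 0 := by
        refine pow_eq_zero_iff two_ne_zero |>.mp (le_antisymm ?_ (sq_nonneg u))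
        nlinarith [sq_nonneg v]
      have hv : v = 0 := by
        rw [hu] at h
        have : (m : ℚ) * v ^ 2 = 0 := by linarith
        exact pow_eq_zero_iff two_ne_zero |>.mp ((mul_eq_zero.mp this).resolve_left hm'.ne)
      exact ⟨0, 0, by simp [hu, hv]⟩
    · have h' : (u : ℂ) ^ 2 - m * v ^ 2 ≠ 0 := by exact_mod_cast h
      refine ⟨u / (u ^ 2 - m * v ^ 2), -v / (u ^ 2 - m * v ^ 2), ?_⟩
      push_cast
      refine inv_eq_of_mul_eq_one_right ?_
      rw [show ((u : ℂ) + v * s) * (u / (u ^ 2 - m * v ^ 2) + -v / (u ^ 2 - m * v ^ 2) * s) =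
        (u ^ 2 - s ^ 2 * v ^ 2) / (u ^ 2 - m * v ^ 2) by ring, hs2, div_self h']

lemma exists_sqrt {m : ℤ} (hm0 : m < 0) : ∃ s : ℂ, s ^ 2 = m ∧ conj s = -s := by
  refine ⟨Complex.I * (√(-m : ℝ) : ℝ), ?_, by simp⟩
  have h : ((√(-m : ℝ) : ℝ) : ℂ) ^ 2 = -m := by
    rw [← Complex.ofReal_pow, Real.sq_sqrt (by
      rw [neg_nonneg]; exact_mod_cast hm0.le)]
    simp
  rw [mul_pow, Complex.I_sq, h]
  ring

lemma quadraticField_eq_adjoin {d m c : ℤ} {s : ℂ} (hs2 : s ^ 2 = m) (hc : c ≠ 0)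
    (hd : d = c ^ 2 * m) : QuadraticField d = IntermediateField.adjoin ℚ {s} := by
  have hc' : (c : ℂ) ≠ 0 := by exact_mod_cast hc
  refine le_antisymm (IntermediateField.adjoin_le_iff.mpr ?_)
    (IntermediateField.adjoin_le_iff.mpr ?_)
  · intro z hz
    have hz' : z ^ 2 = (c * s) ^ 2 := by
      rw [Set.mem_ofPred_eq.mp hz, mul_pow, hs2, hd]; push_cast; ring
    have hcs : (c : ℂ) * s ∈ IntermediateField.adjoin ℚ {s} :=
      mul_mem (intCast_mem _ c) (IntermediateField.mem_adjoin_simple_self ℚ s)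
    rcases sq_eq_sq_iff_eq_or_eq_neg.mp hz' with rfl | rfl
    · exact hcs
    · exact neg_mem hcs
  · rintro z hz
    rw [Set.mem_singleton_iff.mp hz]
    have hcs : (c : ℂ) * s ∈ QuadraticField d := by
      refine IntermediateField.subset_adjoin _ _ ?_
      rw [Set.mem_ofPred_eq, mul_pow, hs2, hd]; push_cast; ring
    have := mul_mem (inv_mem (intCast_mem (QuadraticField d) c)) hcs
    rwa [inv_mul_cancel_left₀ hc'] at this

lemma numberField_of_eq_adjoin {K : IntermediateField ℚ ℂ} {m : ℤ} {s : ℂ} (hs2 : s ^ 2 = m)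
    (hK : K = IntermediateField.adjoin ℚ {s}) : NumberField K := by
  subst hK
  have hint : IsIntegral ℚ s := by
    refine .of_pow two_pos ?_
    rw [hs2, ← map_intCast (algebraMap ℚ ℂ)]
    exact isIntegral_algebraMap
  have := IntermediateField.adjoin.finiteDimensional hint
  exact { }

theorem two_mul_h_le {D : ℕ} (hD : IsFundamentalDiscriminant (-(D : ℤ))) :
    2 * h (-(D : ℤ)) ≤ 2 ^ D.primeFactors.card * p (-(D : ℤ)) := by
  obtain ⟨m, c, hc, hm, hm0, hdm, hDm⟩ : ∃ m c : ℤ, c ≠ 0 ∧ Squarefree m ∧ m < 0 ∧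
      -(D : ℤ) = c ^ 2 * m ∧
      ((m % 4 = 1 ∧ (D : ℤ) = -m) ∨ ((m % 4 = 2 ∨ m % 4 = 3) ∧ (D : ℤ) = -(4 * m))) := by
    rcases hD.2 with ⟨h1, h2⟩ | ⟨m, h1, h2, h3⟩
    · exact ⟨-D, 1, one_ne_zero, h2, by omega, by ring, Or.inl ⟨h1, by ring⟩⟩
    · exact ⟨m, 2, two_ne_zero, h3, by omega, by rw [h1]; ring, Or.inr ⟨h2, by omega⟩⟩
  obtain ⟨s, hs2, hconj⟩ := exists_sqrt hm0
  have hK := quadraticField_eq_adjoin hs2 hc hdm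
  have := numberField_of_eq_adjoin hs2 hK
  refine two_mul_natCard_classGroup_le_of_sqrt hm hm0 hDm ?_ hs2 hconj ?_
  · rw [hK]
    exact IntermediateField.mem_adjoin_simple_self ℚ s
  · intro x hx
    rw [hK] at hx
    exact exists_eq_add_mul_of_mem_adjoin hm0 hs2 hx

end GenusBound

/-! ### Combining the two bounds. -/

theorem mainTheorem3 (D : ℕ)
    (hD : GenusBound.IsFundamentalDiscriminant (-(D : ℤ)))
    (hCI : (D : ℝ) ^ (1 / 2 : ℝ) / Real.log (D : ℝ) ^ 74 ≤ (GenusBound.h (-(D : ℤ)) : ℝ)) :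
    2 * ((D : ℝ) ^ (1 / 2 - Real.log 2 / GenusBound.lambertW (Real.log (D : ℝ)))
        / Real.log (D : ℝ) ^ 74) ≤ (GenusBound.p (-(D : ℤ)) : ℝ) := by
  have hD1 : 1 < D ∧ (Odd D ∨ 4 ∣ D) := by
    rcases hD.2 with ⟨h1, -⟩ | ⟨m, h1, h2, -⟩
    · exact ⟨by omega, Or.inl (Nat.odd_iff.mpr (by omega))⟩
    · exact ⟨by omega, Or.inr (by omega)⟩
  have hDpos : (0 : ℝ) < D := by exact_mod_cast zero_lt_one.trans hD1.1
  have hω := GenusBound.two_pow_le_rpow_lambertW hD1.1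
    (GenusBound.card_primeFactors_pow_self_le (by omega) hD1.2)
  have hh : 2 * (GenusBound.h (-(D : ℤ)) : ℝ) ≤
      2 ^ D.primeFactors.card * (GenusBound.p (-(D : ℤ)) : ℝ) := by
    exact_mod_cast GenusBound.two_mul_h_le hD
  rw [Real.rpow_sub hDpos, div_right_comm, ← mul_div_assoc, div_le_iff₀ (by positivity), mul_comm
    (GenusBound.p _ : ℝ)]
  calc _ ≤ 2 * (GenusBound.h (-(D : ℤ)) : ℝ) := by gcongr
    _ ≤ _ := hh
    _ ≤ _ := by gcongr
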